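/- Let $\mathbb{K}$ be a field of characteristic zero, let $A$ be a unital associative $\mathbb{K}$-algebra with a linear form $\varphi: A\to\mathbb{K}$ such that $\varphi(1_A)=1$, and let $a\in A$ be centered, $\varphi(a)=0$. Let $\mathrm{M}(x)=1+\sum_{n\ge 1}\varphi(a^n)x^n$ be the moment series of $a$. The free cumulants $\mathrm{k}^{(p)}$ of $a$ are the coefficients of the formal power series $\mathrm{K}(y)=\sum_{p\geq 1}\mathrm{k}^{(p)}y^p$ determined by $\mathrm{M}(x)=1+\mathrm{K}(x\mathrm{M}(x))$. Assume that $\mathrm{k}^{(2)}\neq 0$. The conjugate field $\Phi=\Phi(y)=\sum_{p\ge 2}\mathrm{k}^{(p)}y^{p-1}$ is the planar derivative of $\mathrm{K}$, where the planar derivative sends $y^{p}$ to $y^{p-1}$ for $p\ge1$ and kills constants. Because $\mathrm{k}^{(2)}\ne0$, every formal power series in $y$ can be rewritten uniquely as a formal power series in $\Phi$. The effective action is the series $\mathrm{L}(\Phi)=\sum_{k\ge1}\ell^{(k)}\Phi^k$ determined by $\mathrm{L}(\Phi)=\Phi\, y$, and its coefficients $\ell^{(k)}$ are called one-particle irreducible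 (1PI). A Schröder tree is a planar rooted tree all of whose internal vertices have at least two children. For $m\ge 1$ let $PST(m)$ be the set of planted Schröder trees with $m$ leaves: Schröder trees with $m$ leaves and one additional edge attached below the root, whose lower end is neither a leaf nor an internal vertex. For $t\in PST(m)$ let $\text{vert}(t)$ be the set of internal vertices of $t$, let $\text{e}(t)$ be the number of edges connecting two internal vertices, and for $v\in\text{vert}(t)$ let $\text{ar}(v)$ be the total number of edges incident to $v$, the planting edge included, so that $\text{ar}(v)\geq 3$ is one more than the number of children of $v$. Then for every $n>2$, $$\mathrm{k}^{(n)}\,(\mathrm{k}^{(2)})^{-n}=\sum_{t\in PST(n-1)}(\mathrm{k}^{(2)})^{\text{e}(t)}\prod_{v\in\text{vert}(t)}\bigl(-\ell^{(\text{ar}(v))}\bigr).$$ -/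

import Mathlib

open PowerSeries

namespace FreeEffectiveAction

section Series

variable {𝕂 : Type*} [Field 𝕂]

/-- The expansion of the series `f` as a formal power series in the new variable `y`:
the series `g` with `g(y(x)) = f(x)`. It exists and is unique as soon as `y` has zero constant
term and nonzero linear term, see `existsUnique_subst_eq`. -/
noncomputable def expandIn (y f : 𝕂⟦X⟧) : 𝕂⟦X⟧ :=
  Classical.epsilon fun g : 𝕂⟦X⟧ => g.subst y = f

theorem coeff_pow_eq_zero {y : 𝕂⟦X⟧} (h0 : constantCoeff y = 0) {n k : ℕ} (h : n < k) :
    coeff n (y ^ k) = 0 := by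
  obtain ⟨z, rfl⟩ := X_dvd_iff.mpr h0
  rw [mul_pow, coeff_X_pow_mul', if_neg (not_le.mpr h)]

theorem coeff_pow_self {y : 𝕂⟦X⟧} (h0 : constantCoeff y = 0) (n : ℕ) :
    coeff n (y ^ n) = coeff 1 y ^ n := by
  obtain ⟨z, rfl⟩ := X_dvd_iff.mpr h0
  rw [mul_pow, coeff_X_pow_mul', if_pos le_rfl, Nat.sub_self]
  have h1 : coeff 1 (X * z) = constantCoeff z := by
    rw [← coeff_zero_eq_constantCoeff_apply]; exact coeff_succ_X_mul 0 z
  rw [h1, coeff_zero_eq_constantCoeff_apply, map_pow]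

theorem coeff_subst_eq_sum {y : 𝕂⟦X⟧} (h0 : constantCoeff y = 0) (g : 𝕂⟦X⟧) (n : ℕ) :
    coeff n (g.subst y) = ∑ k ∈ Finset.range (n + 1), coeff k g * coeff n (y ^ k) := by
  rw [coeff_subst' (HasSubst.of_constantCoeff_zero' h0),
    finsum_eq_sum_of_support_subset (s := Finset.range (n + 1))]
  · simp [smul_eq_mul]
  · intro k hk
    simp only [Finset.coe_range, Set.mem_Iio]
    by_contra hlt
    exact hk (by simp [coeff_pow_eq_zero h0 (show n < k by omega)])

/-- Coefficients of the expansion of `f` in the variable `y`, by triangular elimination. -/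
noncomputable def expandCoeff (y f : 𝕂⟦X⟧) (n : ℕ) : 𝕂 :=
  (coeff n f - ∑ k : Fin n, expandCoeff y f k * coeff n (y ^ (k : ℕ))) / coeff 1 y ^ n
termination_by n

/-- Formal change of variable. -/
theorem existsUnique_subst_eq {y : 𝕂⟦X⟧} (h0 : constantCoeff y = 0) (h1 : coeff 1 y ≠ 0)
    (f : 𝕂⟦X⟧) : ∃! g : 𝕂⟦X⟧, g.subst y = f := by
  refine ⟨mk (expandCoeff y f), ?_, ?_⟩
  · ext n
    rw [coeff_subst_eq_sum h0, Finset.sum_range_succ, coeff_pow_self h0, coeff_mk, expandCoeff,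
      div_mul_cancel₀ _ (pow_ne_zero n h1), ← Fin.sum_univ_eq_sum_range
        (fun k => coeff k (mk (expandCoeff y f)) * coeff n (y ^ k))]
    simp
  · intro g hg
    ext n
    induction n using Nat.strong_induction_on with
    | _ n ih =>
      have h := congrArg (coeff n) hg
      rw [coeff_subst_eq_sum h0, Finset.sum_range_succ, coeff_pow_self h0,
        ← Fin.sum_univ_eq_sum_range (fun k => coeff k g * coeff n (y ^ k))] at h
      rw [coeff_mk, expandCoeff, eq_div_iff (pow_ne_zero n h1), ← h]
      have h2 : ∑ k : Fin n, coeff (k : ℕ) g * coeff n (y ^ (k : ℕ))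
          = ∑ k : Fin n, expandCoeff y f k * coeff n (y ^ (k : ℕ)) :=
        Finset.sum_congr rfl fun k _ => by rw [ih k k.2, coeff_mk]
      rw [h2]; ring

theorem subst_expandIn {y : 𝕂⟦X⟧} (h0 : constantCoeff y = 0) (h1 : coeff 1 y ≠ 0)
    (f : 𝕂⟦X⟧) : (expandIn y f).subst y = f :=
  Classical.epsilon_spec (existsUnique_subst_eq h0 h1 f).exists

/-- The planar (left) derivative with respect to the single variable: it strips one letter off
each monomial, `x ^ (n + 1) ↦ x ^ n`, and kills the constants. -/
noncomputable def planarDeriv (f : 𝕂⟦X⟧) : 𝕂⟦X⟧ :=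
  mk fun n => coeff (n + 1) f

end Series

section Probability

variable {𝕂 : Type*} [Field 𝕂] {A : Type*} [Ring A] [Algebra 𝕂 A]

/-- The moment series `M(x) = ∑ φ(aⁿ) xⁿ` of a non-commutative random variable `a`. -/
noncomputable def momentSeries (φ : A →ₗ[𝕂] 𝕂) (a : A) : 𝕂⟦X⟧ :=
  mk fun n => φ (a ^ n)

/-- The free cumulant series `K`, i.e. the expansion of `M(x) - 1` in `y = x M(x)`. -/
noncomputable def freeCumulantSeries (φ : A →ₗ[𝕂] 𝕂) (a : A) : 𝕂⟦X⟧ :=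
  expandIn (X * momentSeries φ a) (momentSeries φ a - 1)

/-- The free cumulant `k⁽ⁿ⁾` of `a`. -/
noncomputable def freeCumulant (φ : A →ₗ[𝕂] 𝕂) (a : A) (n : ℕ) : 𝕂 :=
  coeff n (freeCumulantSeries φ a)

/-- The conjugate field `Φ(y) = ∂K(y)/∂y` (planar derivative), as a series in `y`. -/
noncomputable def conjugateField (φ : A →ₗ[𝕂] 𝕂) (a : A) : 𝕂⟦X⟧ :=
  planarDeriv (freeCumulantSeries φ a)

/-- The effective action `L`, i.e. the expansion in the variable `Φ = Φ(y)` of `Φ(y) y`. -/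
noncomputable def effectiveAction (φ : A →ₗ[𝕂] 𝕂) (a : A) : 𝕂⟦X⟧ :=
  expandIn (conjugateField φ a) (conjugateField φ a * X)

/-- The one-particle irreducible coefficient `ℓ⁽ᵏ⁾`: the coefficient of `Φᵏ` in `L(Φ)`. -/
noncomputable def onePI (φ : A →ₗ[𝕂] 𝕂) (a : A) (k : ℕ) : 𝕂 :=
  coeff k (effectiveAction φ a)

/-- `M(x) = 1 + K(x M(x))`. -/
theorem momentSeries_eq {φ : A →ₗ[𝕂] 𝕂} (hφ : φ 1 = 1) (a : A) :
    momentSeries φ a = 1 + (freeCumulantSeries φ a).subst (X * momentSeries φ a) := by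
  have h0 : constantCoeff (X * momentSeries φ a) = 0 := by simp
  have h1 : coeff 1 (X * momentSeries φ a) ≠ 0 := by
    rw [show (1 : ℕ) = 0 + 1 from rfl, coeff_succ_X_mul]
    simp [momentSeries, hφ]
  rw [freeCumulantSeries, subst_expandIn h0 h1]; ring

theorem freeCumulant_zero {φ : A →ₗ[𝕂] 𝕂} (hφ : φ 1 = 1) (a : A) :
    freeCumulant φ a 0 = 0 := by
  have h := congrArg (coeff 0) (momentSeries_eq hφ a)
  rw [map_add, coeff_subst_eq_sum (by simp)] at h
  simpa [momentSeries, hφ, freeCumulant] using h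

theorem freeCumulant_one {φ : A →ₗ[𝕂] 𝕂} (hφ : φ 1 = 1) (a : A) :
    freeCumulant φ a 1 = φ a := by
  have h := congrArg (coeff 1) (momentSeries_eq hφ a)
  rw [map_add, coeff_subst_eq_sum (by simp)] at h
  have h1 : coeff 1 (X * momentSeries φ a) = 1 := by
    rw [show (1 : ℕ) = 0 + 1 from rfl, coeff_succ_X_mul]
    simp [momentSeries, hφ]
  simp only [Finset.sum_range_succ, Finset.range_zero, Finset.sum_empty, pow_zero, pow_one, h1,
    coeff_one] at h
  simpa [momentSeries, freeCumulant] using h.symm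

/-- `L(Φ) = Φ y`, for a centered variable with `k⁽²⁾ ≠ 0` (i.e. when `Φ` is regular). -/
theorem effectiveAction_subst {φ : A →ₗ[𝕂] 𝕂} (hφ : φ 1 = 1) {a : A} (ha : φ a = 0)
    (hk : freeCumulant φ a 2 ≠ 0) :
    (effectiveAction φ a).subst (conjugateField φ a) = conjugateField φ a * X := by
  refine subst_expandIn ?_ ?_ _
  · rw [← coeff_zero_eq_constantCoeff_apply, conjugateField, planarDeriv, coeff_mk]
    exact (freeCumulant_one hφ a).trans ha
  · rw [conjugateField, planarDeriv, coeff_mk]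
    exact hk

end Probability

/-- Schröder trees: planar rooted trees in which every internal vertex has at least two
children; `node k c` has root an internal vertex with the `k + 2` ordered subtrees
`c 0, …, c (k + 1)`. -/
inductive SchroederTree : Type
  | leaf : SchroederTree
  | node (k : ℕ) (c : Fin (k + 2) → SchroederTree) : SchroederTree

namespace SchroederTree

/-- Number of leaves. -/
def numLeaves : SchroederTree → ℕ
  | leaf => 1
  | node _ c => ∑ i, (c i).numLeaves

/-- `1` if the root of the tree is an internal vertex, `0` if the tree is a single leaf. -/
def rootIsInternal : SchroederTree → ℕ
  | leaf => 0
  | node _ _ => 1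

/-- `e(t)`: number of edges joining two internal vertices. An edge from an internal vertex to a
child is counted exactly if the child is again internal. -/
def numInternalEdges : SchroederTree → ℕ
  | leaf => 0
  | node _ c => ∑ i, ((c i).rootIsInternal + (c i).numInternalEdges)

/-- The multiset of the arities of the internal vertices of the planted tree. The arity of a
vertex is its total number of incident edges: the edges to its children, and the edge below it
(for the root, the planting edge). A vertex with `k + 2` children has arity `k + 3`. -/
def arities : SchroederTree → Multiset ℕ
  | leaf => 0
  | node k c => (k + 3) ::ₘ ∑ i, (c i).arities

theorem one_le_numLeaves (t : SchroederTree) : 1 ≤ t.numLeaves := by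
  induction t with
  | leaf => exact le_rfl
  | node k c ih => exact (ih 0).trans (Finset.single_le_sum (f := fun i => (c i).numLeaves)
      (fun _ _ => Nat.zero_le _) (Finset.mem_univ 0))

theorem le_numLeaves_node (k : ℕ) (c : Fin (k + 2) → SchroederTree) :
    k + 2 ≤ (node k c).numLeaves := by
  have h := Finset.sum_le_sum (s := Finset.univ) (fun i _ => one_le_numLeaves (c i))
  simpa [numLeaves] using h

theorem numLeaves_child_lt (k : ℕ) (c : Fin (k + 2) → SchroederTree) (i : Fin (k + 2)) :
    (c i).numLeaves < (node k c).numLeaves := by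
  obtain ⟨j, hj⟩ := exists_ne i
  exact Finset.single_lt_sum (f := fun i => (c i).numLeaves) hj (Finset.mem_univ i)
    (Finset.mem_univ j) (one_le_numLeaves (c j)) (fun _ _ _ => Nat.zero_le _)

theorem finite_numLeaves_le (m : ℕ) : {t : SchroederTree | t.numLeaves ≤ m}.Finite := by
  induction m with
  | zero =>
    refine Set.Finite.subset Set.finite_empty fun t ht => ?_
    have := one_le_numLeaves t
    simp only [Set.mem_ofPred_eq] at ht
    omega
  | succ m ih =>
    have := ih.to_subtype
    refine ((Set.finite_singleton leaf).union (Set.finite_range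
      (fun p : Σ k : Fin m, Fin (k + 2) → {t : SchroederTree | t.numLeaves ≤ m} =>
        node p.1 fun i => (p.2 i).1))).subset fun t ht => ?_
    cases t with
    | leaf => exact Or.inl rfl
    | node k c =>
      simp only [Set.mem_ofPred_eq] at ht
      have h1 := le_numLeaves_node k c
      refine Or.inr ⟨⟨⟨k, by omega⟩, fun i => ⟨c i, ?_⟩⟩, rfl⟩
      have h2 := numLeaves_child_lt k c i
      simp only [Set.mem_ofPred_eq]
      omega

end SchroederTree

/-- `PST(m)`: planted Schröder trees with `m` leaves, i.e. Schröder trees with `m` leaves and an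
additional edge attached below the root (the foot of that edge is not counted as a leaf). Since
the planting edge carries no choice, such a tree is given by its underlying Schröder tree; the
planting edge enters through the arity of the root. -/
abbrev PST (m : ℕ) : Type := {t : SchroederTree // t.numLeaves = m}

noncomputable instance instFintypePST (m : ℕ) : Fintype (PST m) :=
  ((SchroederTree.finite_numLeaves_le m).subset fun _ ht => le_of_eq ht).fintype

end FreeEffectiveAction

/-! Write `f` for the planar derivative of the effective action. Cancelling `Φ` in `L(Φ) = Φ y`
gives `f(Φ(y)) = y`, so the theorem is the tree formula for the compositional inverse of `f`. Give
each leaf weight `x = k⁽²⁾` and each vertex of arity `r` weight `-x ℓ⁽ʳ⁾`. Cutting a tree at its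
root (`coeff_weightSeries`) shows that the weighted tree series `P` also satisfies `f(P) = X`, since
`ℓ⁽²⁾ x = 1`. Right inverses being unique, `Φ = P`. In degree `n - 1` each tree then carries `x` to
the power leaves plus vertices, which is `n + e(t)` (`weight_eq`). -/

namespace FreeEffectiveAction

/-! ### Uniqueness of compositional inverses. -/

section RightInverse

variable {𝕂 : Type*} [Field 𝕂]

/-- A left and a right compositional inverse of the same series agree. -/
theorem eq_of_leftInverse_subst {f r s : 𝕂⟦X⟧} (f0 : constantCoeff f = 0)
    (s0 : constantCoeff s = 0) (hr : r.subst f = (X : 𝕂⟦X⟧)) (hs : f.subst s = (X : 𝕂⟦X⟧)) : s = r := by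
  have hf := HasSubst.of_constantCoeff_zero' f0
  have hsub := HasSubst.of_constantCoeff_zero' s0
  -- Associativity: `r ∘ f ∘ s` is both `s` and `r`.
  have h := subst_comp_subst_apply hf hsub r
  rw [hr, hs, subst_X hsub, X_subst] at h
  exact h

/-- Right compositional inverses of an invertible formal diffeomorphism are unique. -/
theorem eq_of_subst_eq_X {f g h : 𝕂⟦X⟧} (f0 : constantCoeff f = 0) (f1 : coeff 1 f ≠ 0)
    (g0 : constantCoeff g = 0) (h0 : constantCoeff h = 0) (hg : f.subst g = (X : 𝕂⟦X⟧))
    (hh : f.subst h = (X : 𝕂⟦X⟧)) : g = h := by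
  obtain ⟨r, hr, -⟩ := existsUnique_subst_eq f0 f1 (X : 𝕂⟦X⟧)
  exact (eq_of_leftInverse_subst f0 g0 hr hg).trans (eq_of_leftInverse_subst f0 h0 hr hh).symm

end RightInverse

/-! ### Weighted enumeration of Schröder trees. -/

namespace SchroederTree

section Weight

variable {R : Type*} [CommSemiring R]

/-- The multiplicative weight of a tree: `x` for each leaf and `q k` for each internal vertex
with `k + 2` children. -/
def weight (x : R) (q : ℕ → R) : SchroederTree → R
  | leaf => x
  | node k c => q k * ∏ i, (c i).weight x q

/-- The finite set of trees with `m` leaves. -/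
noncomputable def withLeaves (m : ℕ) : Finset SchroederTree :=
  ((finite_numLeaves_le m).subset (t := {t | t.numLeaves = m})
    fun _ ht => le_of_eq ht).toFinset

@[simp]
theorem mem_withLeaves {m : ℕ} {t : SchroederTree} : t ∈ withLeaves m ↔ t.numLeaves = m := by
  simp [withLeaves]

/-- The generating series of weighted trees by number of leaves. -/
noncomputable def weightSeries (x : R) (q : ℕ → R) : R⟦X⟧ :=
  mk fun m => ∑ t ∈ withLeaves m, t.weight x q

theorem constantCoeff_weightSeries (x : R) (q : ℕ → R) :
    constantCoeff (weightSeries x q) = 0 := by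
  rw [← coeff_zero_eq_constantCoeff_apply, weightSeries, coeff_mk]
  refine Finset.sum_eq_zero fun t ht => ?_
  have := one_le_numLeaves t
  rw [mem_withLeaves] at ht
  omega

theorem withLeaves_one : withLeaves 1 = {leaf} := by
  ext t
  rw [mem_withLeaves, Finset.mem_singleton]
  cases t with
  | leaf => simp [numLeaves]
  | node k c =>
    have := le_numLeaves_node k c
    simp only [reduceCtorEq, iff_false]
    omega

theorem coeff_one_weightSeries (x : R) (q : ℕ → R) : coeff 1 (weightSeries x q) = x := by
  simp [weightSeries, withLeaves_one, weight]

/-- A `k`-th power enumerates ordered forests of `k` trees: `j` records how the `m` leaves are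
shared out. These are the children of a root. -/
theorem coeff_weightSeries_pow (x : R) (q : ℕ → R) (k m : ℕ) :
    coeff m (weightSeries x q ^ k) =
      ∑ j ∈ Finset.finsuppAntidiag (Finset.univ : Finset (Fin k)) m,
        ∑ c ∈ Fintype.piFinset fun i => withLeaves (j i), ∏ i, (c i).weight x q := by
  rw [show weightSeries x q ^ k = ∏ _i : Fin k, weightSeries x q by simp, coeff_prod]
  refine Finset.sum_congr rfl fun j _ => ?_
  simp only [weightSeries, coeff_mk]
  rw [Finset.prod_univ_sum]

/-- Decomposition of a tree at its root. -/
theorem coeff_weightSeries (x : R) (q : ℕ → R) {m : ℕ} (hm : 2 ≤ m) :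
    coeff m (weightSeries x q) =
      ∑ k ∈ Finset.range (m - 1), q k * coeff m (weightSeries x q ^ (k + 2)) := by
  simp only [coeff_weightSeries_pow, Finset.mul_sum]
  rw [weightSeries, coeff_mk]
  simp only [Finset.sum_sigma']
  symm
  refine Finset.sum_bij (fun p _ => node p.1 p.2.2) ?_ ?_ ?_ ?_
  · rintro ⟨k, j, c⟩ h
    simp only [Finset.mem_sigma, Finset.mem_finsuppAntidiag, Fintype.mem_piFinset,
      mem_withLeaves] at h
    simp only [mem_withLeaves, numLeaves, h.2.2, ← h.2.1.1]
  · rintro ⟨k, j, c⟩ h ⟨k', j', c'⟩ h' e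
    simp only [Finset.mem_sigma, Finset.mem_finsuppAntidiag, Fintype.mem_piFinset,
      mem_withLeaves] at h h'
    obtain ⟨rfl, e⟩ := node.inj e
    obtain rfl := eq_of_heq e
    -- The distribution of leaves is no extra data: it is read off from the subtrees.
    obtain rfl : j = j' := Finsupp.ext fun i => (h.2.2 i).symm.trans (h'.2.2 i)
    rfl
  · intro t ht
    rw [mem_withLeaves] at ht
    cases t with
    | leaf => simp only [numLeaves] at ht; omega
    | node k c =>
      have := le_numLeaves_node k c
      refine ⟨⟨k, Finsupp.equivFunOnFinite.symm fun i => (c i).numLeaves, c⟩, ?_, rfl⟩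
      simp only [Finset.mem_sigma, Finset.mem_finsuppAntidiag, Fintype.mem_piFinset,
        mem_withLeaves, Finset.mem_range]
      refine ⟨by omega, ⟨?_, Finset.subset_univ _⟩, fun i => rfl⟩
      simpa [numLeaves] using ht
  · rintro ⟨k, j, c⟩ -
    rfl

/-- One factor `x` comes from each leaf and each internal vertex. Every internal vertex but the root
sits on top of exactly one internal edge, so the vertices number `rootIsInternal +
numInternalEdges`. -/
theorem weight_eq {R : Type*} [CommRing R] (x : R) (l : ℕ → R) (t : SchroederTree) :
    t.weight x (fun k => x * -l (k + 3)) =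
      x ^ (t.numLeaves + t.rootIsInternal + t.numInternalEdges) *
        (t.arities.map fun r => -l r).prod := by
  induction t with
  | leaf => simp [weight, numLeaves, rootIsInternal, numInternalEdges, arities]
  | node k c ih =>
    simp only [weight, ih, numLeaves, rootIsInternal, numInternalEdges, arities,
      Finset.prod_mul_distrib, Finset.prod_pow_eq_pow_sum, Multiset.map_cons, Multiset.prod_cons,
      Finset.sum_add_distrib]
    have h : ((∑ i, (c i).arities).map fun r => -l r).prod =
        ∏ i, ((c i).arities.map fun r => -l r).prod := by
      rw [← Multiset.coe_mapAddMonoidHom, map_sum]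
      exact Multiset.prod_sum _ _
    rw [h]
    ring

end Weight

end SchroederTree

/-! ### Trees invert a formal series. -/

section Inverse

open SchroederTree

variable {𝕂 : Type*} [Field 𝕂]

/-- Inversion of a formal series by Schröder trees. -/
theorem subst_weightSeries_eq_X {x : 𝕂} (f : 𝕂⟦X⟧) (f0 : constantCoeff f = 0)
    (f1 : coeff 1 f * x = 1) :
    f.subst (weightSeries x fun k => x * -coeff (k + 2) f) = X := by
  set P := weightSeries x fun k => x * -coeff (k + 2) f with hP
  have P0 : constantCoeff P = 0 := constantCoeff_weightSeries _ _
  have P1 : coeff 1 P = x := coeff_one_weightSeries _ _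
  rw [← coeff_zero_eq_constantCoeff_apply] at f0
  ext m
  rw [coeff_subst_eq_sum P0]
  match m with
  | 0 => simp [f0]
  | 1 => simp [Finset.sum_range_succ, f0, P1, f1]
  | m + 2 =>
    have h := coeff_weightSeries x (fun k => x * -coeff (k + 2) f) (m := m + 2) (by omega)
    rw [← hP, show m + 2 - 1 = m + 1 from rfl] at h
    -- The linear term of `f` is split off. Expanded by the root decomposition, it cancels the
    -- higher terms one by one, because `coeff 1 f * x = 1`.
    rw [Finset.sum_range_succ', Finset.sum_range_succ', f0, coeff_X, if_neg (by omega)]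
    simp only [zero_add, pow_one, zero_mul, add_zero]
    rw [h, Finset.mul_sum, ← Finset.sum_add_distrib]
    refine Finset.sum_eq_zero fun k _ => ?_
    linear_combination (-coeff (k + 2) f * coeff (m + 2) (P ^ (k + 2))) * f1

end Inverse

/-! ### The conjugate field as a tree series. -/

section Probability

open SchroederTree

variable {𝕂 : Type*} [Field 𝕂] {A : Type*} [Ring A] [Algebra 𝕂 A]

/-- The planar derivative of the effective action is a left inverse of the conjugate field. -/
theorem planarDeriv_effectiveAction_subst {φ : A →ₗ[𝕂] 𝕂} (hφ : φ 1 = 1) {a : A} (ha : φ a = 0)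
    (hk : freeCumulant φ a 2 ≠ 0) :
    (planarDeriv (effectiveAction φ a)).subst (conjugateField φ a) = X := by
  have h0 : constantCoeff (conjugateField φ a) = 0 := by
    rw [← coeff_zero_eq_constantCoeff_apply, conjugateField, planarDeriv, coeff_mk]
    exact (freeCumulant_one hφ a).trans ha
  have hsub := HasSubst.of_constantCoeff_zero' h0
  have hne : conjugateField φ a ≠ 0 := fun h => hk <| by
    have h2 := congrArg (coeff 1) h
    rwa [conjugateField, planarDeriv, coeff_mk, map_zero] at h2
  have hL := effectiveAction_subst hφ ha hk
  have hl0 : coeff 0 (effectiveAction φ a) = 0 := by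
    have h := congrArg (coeff 0) hL
    rw [coeff_subst_eq_sum h0] at h
    simpa using h
  have hX : effectiveAction φ a = X * planarDeriv (effectiveAction φ a) := by
    ext n
    cases n with
    | zero => rw [hl0, coeff_zero_X_mul]
    | succ n => rw [coeff_succ_X_mul, planarDeriv, coeff_mk]
  rw [hX, subst_mul hsub, subst_X hsub] at hL
  exact mul_left_cancel₀ hne hL

/-- The conjugate field is the generating series of Schröder trees weighted by the 1PI
coefficients. -/
theorem conjugateField_eq_weightSeries {φ : A →ₗ[𝕂] 𝕂} (hφ : φ 1 = 1) {a : A} (ha : φ a = 0)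
    (hk : freeCumulant φ a 2 ≠ 0) :
    conjugateField φ a =
      weightSeries (freeCumulant φ a 2) fun k => freeCumulant φ a 2 * -onePI φ a (k + 3) := by
  have h0 : constantCoeff (conjugateField φ a) = 0 := by
    rw [← coeff_zero_eq_constantCoeff_apply, conjugateField, planarDeriv, coeff_mk]
    exact (freeCumulant_one hφ a).trans ha
  have hΦ := planarDeriv_effectiveAction_subst hφ ha hk
  have f0 : constantCoeff (planarDeriv (effectiveAction φ a)) = 0 := by
    have h := congrArg (coeff 0) hΦ
    rw [coeff_subst_eq_sum h0] at h
    simpa using h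
  -- This is `ℓ⁽²⁾ k⁽²⁾ = 1`, so the leaf weight inverts the linear coefficient.
  have f1 : coeff 1 (planarDeriv (effectiveAction φ a)) * freeCumulant φ a 2 = 1 := by
    have h := congrArg (coeff 1) hΦ
    rw [coeff_subst_eq_sum h0] at h
    simp only [Finset.sum_range_succ, Finset.range_zero, Finset.sum_empty, pow_zero, pow_one,
      coeff_one] at h
    simpa [conjugateField, planarDeriv, freeCumulant] using h
  have hS := subst_weightSeries_eq_X _ f0 f1
  -- The planar derivative shifts indices by one: `k + 2` children become `ℓ` at the arity `k + 3`.
  simp only [planarDeriv, coeff_mk] at hS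
  exact eq_of_subst_eq_X f0 (left_ne_zero_of_mul_eq_one f1) h0 (constantCoeff_weightSeries _ _)
    hΦ hS

end Probability

end FreeEffectiveAction

theorem mainTheorem3 {𝕂 : Type*} [Field 𝕂] [CharZero 𝕂] {A : Type*} [Ring A] [Algebra 𝕂 A]
    (φ : A →ₗ[𝕂] 𝕂) (hφ : φ 1 = 1) (a : A) (ha : φ a = 0)
    (hk : FreeEffectiveAction.freeCumulant φ a 2 ≠ 0) (n : ℕ) (hn : 2 < n) :
    FreeEffectiveAction.freeCumulant φ a n * FreeEffectiveAction.freeCumulant φ a 2 ^ (-(n : ℤ)) =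
      ∑ t : FreeEffectiveAction.PST (n - 1),
        FreeEffectiveAction.freeCumulant φ a 2 ^ t.1.numInternalEdges *
          (t.1.arities.map fun r => -FreeEffectiveAction.onePI φ a r).prod := by
  open FreeEffectiveAction FreeEffectiveAction.SchroederTree in
  have h := congrArg (coeff (n - 1)) (conjugateField_eq_weightSeries hφ ha hk)
  rw [conjugateField, planarDeriv, coeff_mk, weightSeries, coeff_mk,
    Nat.sub_add_cancel (by omega)] at h
  rw [zpow_neg, zpow_natCast, ← div_eq_mul_inv, div_eq_iff (pow_ne_zero n hk), freeCumulant, h,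
    Finset.sum_mul, ← Finset.sum_subtype (withLeaves (n - 1)) (fun t => mem_withLeaves)
      (fun t => freeCumulant φ a 2 ^ t.numInternalEdges *
        (t.arities.map fun r => -onePI φ a r).prod * freeCumulant φ a 2 ^ n)]
  refine Finset.sum_congr rfl fun t ht => ?_
  rw [mem_withLeaves] at ht
  rw [weight_eq]
  -- There are `n - 1 ≥ 2` leaves, so the root is internal and supplies the missing factor of
  -- `(k⁽²⁾)ⁿ`.
  have hroot : t.numLeaves + t.rootIsInternal = n := by
    cases t with
    | leaf => simp only [numLeaves] at ht; omega
    | node k c => simp only [rootIsInternal]; omega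
  rw [hroot, pow_add]
  ring
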